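/- A permutation $\pi$ of length $n$ contains a permutation $\sigma$ of length $k$ if some subsequence $\pi(i_1),\dots,\pi(i_k)$ with $i_1<\dots<i_k$ is in the same relative order as $\sigma(1),\dots,\sigma(k)$. Let $\operatorname{Av}(2143,4321)$ be the class of permutations that contain neither $2143$ nor $4321$, and let $a_n$ be the number of permutations of length $n$ in it. Proposition. The generating function of the non-empty permutations in $\operatorname{Av}(2143,4321)$ is $$\sum_{n\ge 1} a_n t^n=\frac{t\,p(t)}{(1-2t)^4(1-t)^7(1-3t+t^2)},$$ where $$p(t)=1-16t+117t^2-513t^3+1499t^4-3074t^5+4530t^6-4827t^7+3691t^8-1968t^9+690t^{10}-150t^{11}+16t^{12}.$$ -/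

import Mathlib

open PowerSeries

namespace PatternClass

/-- The permutation `π` of length `n` contains the permutation `σ` of length `k` as a pattern:
some subsequence of `π(1), …, π(n)` is order isomorphic to `σ(1), …, σ(k)`. -/
def Contains {k n : ℕ} (σ : Equiv.Perm (Fin k)) (π : Equiv.Perm (Fin n)) : Prop :=
  ∃ f : Fin k ↪o Fin n, ∀ i j : Fin k, π (f i) < π (f j) ↔ σ i < σ j

/-- The permutations of length `n` in the class `Av(B)`: those that contain no element of `B`. -/
def Av (B : Set (Σ k : ℕ, Equiv.Perm (Fin k))) (n : ℕ) : Set (Equiv.Perm (Fin n)) :=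
  {π | ∀ β ∈ B, ¬ Contains β.2 π}

/-- The generating function `∑_{n ≥ 1} |Av_n(B)| tⁿ` of the non-empty permutations in `Av(B)`. -/
noncomputable def genFun (B : Set (Σ k : ℕ, Equiv.Perm (Fin k))) : ℚ⟦X⟧ :=
  PowerSeries.mk fun n => if n = 0 then 0 else ((Av B n).ncard : ℚ)

/-- The permutation with one-line notation `2143` (positions and values shifted to start at `0`). -/
def perm2143 : Equiv.Perm (Fin 4) where
  toFun := ![1, 0, 3, 2]
  invFun := ![1, 0, 3, 2]
  left_inv := by decide
  right_inv := by decide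

/-- The permutation with one-line notation `4321` (positions and values shifted to start at `0`). -/
def perm4321 : Equiv.Perm (Fin 4) where
  toFun := ![3, 2, 1, 0]
  invFun := ![3, 2, 1, 0]
  left_inv := by decide
  right_inv := by decide

/-- The polynomial `p(t)` of degree 12 in the numerator, as a power series in `t = X`. -/
noncomputable def p : ℚ⟦X⟧ :=
  1 - 16 * X + 117 * X ^ 2 - 513 * X ^ 3 + 1499 * X ^ 4 - 3074 * X ^ 5 + 4530 * X ^ 6
    - 4827 * X ^ 7 + 3691 * X ^ 8 - 1968 * X ^ 9 + 690 * X ^ 10 - 150 * X ^ 11 + 16 * X ^ 12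

end PatternClass

namespace PatternClass

/-! Permutations of the class are grown by appending a value on the right. Deleting the last entry
stays in the class, so each member arises exactly once. A value is an active site if it lies above
the bottom of no 321 (else 4321 appears) and does not complete an inversion followed by a larger
entry to a 2143. To update the active sites one needs only the least inversion top `m` and the
greatest inversion bottom `D - 1`: appending `v` kills the sites `≤ v` if `v < D`, kills the sites
in `(m, v]`, and splits the site `v` into `v` and `v + 1` before these deletions
(`HasState.append`).

Up to the number of active sites in each of the ranges cut out by `m` and `D`, only four kinds of
state occur: increasing, split (`D ≤ m`), crossed (`m < D`), and all sites above `m`. The lemmas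
`cntState_above`, `cntState_crossed`, `cntState_split` and `cntState_incr` turn the tree into four
numerical recurrences.

Their generating functions in the number of steps satisfy linear equations in which every unknown on
the right carries a factor `X`, so the solution is unique (`family_ext`) and a closed form need only
be checked. All closed forms are built from `T = 1/(1-t)`, `U = 1/(1-tT)` and `V = 1/(1-3t+t²)`. For
split states the closed form is bilinear in a vector depending on `a` and one depending on `c`. The
increasing states sum it geometrically in both arguments, which amounts to replacing the vectors by
their sums. The value at the empty permutation is the stated fraction. -/

/-- The number of descendants after `k` steps of a state with `s` active sites, all of them above
the least inversion top. -/
def cntAbove : ℕ → ℕ → ℕ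
  | 0, _ => 1
  | k + 1, s => ∑ j ∈ Finset.range s, cntAbove k (j + 1)

/-- The number of descendants after `k` steps of a state whose least inversion top lies below its
greatest inversion bottom, with `x` active sites below both, `y` between and `z` above both. -/
def cntCrossed : ℕ → ℕ → ℕ → ℕ → ℕ
  | 0, _, _, _ => 1
  | k + 1, x, y, z => ∑ j ∈ Finset.range x, cntCrossed k 1 (j + y) z +
      ∑ j ∈ Finset.range y, cntAbove k (j + 1 + z) +
      ∑ j ∈ Finset.range z, cntCrossed k x 0 (j + 1)

/-- The number of descendants after `k` steps of a state whose greatest inversion bottom lies below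
its least inversion top, with `a` active sites below both, one between and `c + 1` above both. -/
def cntSplit : ℕ → ℕ → ℕ → ℕ
  | 0, _, _ => 1
  | k + 1, a, c => ∑ j ∈ Finset.range a, cntCrossed k 1 j (c + 2) + cntSplit k (a + 1) c +
      cntSplit k a 0 + ∑ j ∈ Finset.range c, cntCrossed k (a + 1) 0 (j + 2)

/-- The number of descendants after `k` steps of the increasing permutation of length `n`. -/
def cntIncr : ℕ → ℕ → ℕ
  | 0, _ => 1
  | k + 1, n => cntIncr k (n + 1) + ∑ v ∈ Finset.range n, cntSplit k (v + 1) (n - 1 - v)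

theorem mk_eq_const_add_X_mul (f : ℕ → ℚ) :
    PowerSeries.mk f = C (f 0) + X * PowerSeries.mk fun k => f (k + 1) := by
  ext k
  cases k <;> simp [coeff_succ_X_mul]

theorem mk_sum {ι : Type*} (s : Finset ι) (f : ι → ℕ → ℚ) :
    PowerSeries.mk (fun k => ∑ i ∈ s, f i k) = ∑ i ∈ s, PowerSeries.mk (f i) := by
  ext k
  simp

theorem mk_add (f g : ℕ → ℚ) :
    PowerSeries.mk (fun k => f k + g k) = PowerSeries.mk f + PowerSeries.mk g := by
  ext k
  simp

/-- Two families of power series that agree to order `k + 1` whenever they agree to order `k` are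
equal. -/
theorem family_ext {ι : Type*} (F G : ι → ℚ⟦X⟧)
    (h : ∀ k : ℕ, (∀ i, X ^ k ∣ F i - G i) → ∀ i, X ^ (k + 1) ∣ F i - G i) (i : ι) :
    F i = G i := by
  have key : ∀ k : ℕ, ∀ i, X ^ k ∣ F i - G i := by
    intro k
    induction k with
    | zero => simp
    | succ k ih => exact h k ih
  ext n
  have := X_pow_dvd_iff.1 (key (n + 1) i) n (Nat.lt_succ_self n)
  rwa [map_sub, sub_eq_zero] at this

theorem X_pow_succ_dvd_X_mul {k : ℕ} {f : ℚ⟦X⟧} (h : X ^ k ∣ f) : X ^ (k + 1) ∣ X * f := by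
  rw [pow_succ']
  exact mul_dvd_mul_left _ h

/-! ### Generating functions in the number of steps and their equations -/

/-- The generating function of `cntAbove` in the number of steps. -/
noncomputable def serAbove (s : ℕ) : ℚ⟦X⟧ := PowerSeries.mk fun k => (cntAbove k s : ℚ)

/-- The generating function of `cntCrossed` in the number of steps. -/
noncomputable def serCrossed (x y z : ℕ) : ℚ⟦X⟧ :=
  PowerSeries.mk fun k => (cntCrossed k x y z : ℚ)

/-- The generating function of `cntSplit` in the number of steps. -/
noncomputable def serSplit (a c : ℕ) : ℚ⟦X⟧ := PowerSeries.mk fun k => (cntSplit k a c : ℚ)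

/-- The generating function of `cntIncr` in the number of steps. -/
noncomputable def serIncr (n : ℕ) : ℚ⟦X⟧ := PowerSeries.mk fun k => (cntIncr k n : ℚ)

theorem serAbove_eq (s : ℕ) :
    serAbove s = 1 + X * ∑ j ∈ Finset.range s, serAbove (j + 1) := by
  rw [serAbove, mk_eq_const_add_X_mul]
  simp [cntAbove, mk_sum, serAbove]

theorem serCrossed_eq (x y z : ℕ) :
    serCrossed x y z = 1 + X * (∑ j ∈ Finset.range x, serCrossed 1 (j + y) z +
      ∑ j ∈ Finset.range y, serAbove (j + 1 + z) +
      ∑ j ∈ Finset.range z, serCrossed x 0 (j + 1)) := by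
  rw [serCrossed, mk_eq_const_add_X_mul]
  simp [cntCrossed, mk_sum, mk_add, serAbove, serCrossed]

theorem serSplit_eq (a c : ℕ) :
    serSplit a c = 1 + X * (∑ j ∈ Finset.range a, serCrossed 1 j (c + 2) + serSplit (a + 1) c +
      serSplit a 0 + ∑ j ∈ Finset.range c, serCrossed (a + 1) 0 (j + 2)) := by
  rw [serSplit, mk_eq_const_add_X_mul]
  simp [cntSplit, mk_sum, mk_add, serSplit, serCrossed]

theorem serIncr_eq (n : ℕ) :
    serIncr n = 1 + X * (serIncr (n + 1) +
      ∑ v ∈ Finset.range n, serSplit (v + 1) (n - 1 - v)) := by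
  rw [serIncr, mk_eq_const_add_X_mul]
  simp [cntIncr, mk_sum, mk_add, serSplit, serIncr]

/-! ### Closed forms for the above and crossed states -/

/-- `1 / (1 - t)` -/
noncomputable def geomT : ℚ⟦X⟧ := (1 - X)⁻¹

/-- `(1 - t) / (1 - 2t)` -/
noncomputable def geomU : ℚ⟦X⟧ := (1 - X) * (1 - 2 * X)⁻¹

/-- `1 / (1 - 3t + t²)` -/
noncomputable def geomV : ℚ⟦X⟧ := (1 - 3 * X + X ^ 2)⁻¹

theorem geomT_mul : geomT * (1 - X) = 1 := by
  rw [geomT]; exact PowerSeries.inv_mul_cancel _ (by simp)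

theorem geomU_mul : geomU * (1 - 2 * X) = 1 - X := by
  rw [geomU, mul_assoc, PowerSeries.inv_mul_cancel _ (by simp), mul_one]

theorem geomV_mul : geomV * (1 - 3 * X + X ^ 2) = 1 := by
  rw [geomV]; exact PowerSeries.inv_mul_cancel _ (by simp)

theorem X_mul_sum_geomT (s : ℕ) :
    (X : ℚ⟦X⟧) * ∑ j ∈ Finset.range s, geomT ^ (j + 1) = geomT ^ s - 1 := by
  induction s with
  | zero => simp
  | succ s ih =>
    rw [Finset.sum_range_succ, mul_add, ih]
    linear_combination (-geomT ^ s) * geomT_mul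

theorem serAbove_closed (s : ℕ) : serAbove s = geomT ^ s := by
  refine family_ext _ _ (fun k hk s => ?_) s
  have : serAbove s - geomT ^ s =
      X * ∑ j ∈ Finset.range s, (serAbove (j + 1) - geomT ^ (j + 1)) := by
    rw [serAbove_eq, Finset.sum_sub_distrib]
    linear_combination X_mul_sum_geomT s
  rw [this]
  exact X_pow_succ_dvd_X_mul (Finset.dvd_sum fun j _ => hk _)

theorem X_mul_geomT_mul_geomU : X * (geomT * geomU) = geomU - 1 := by
  linear_combination (-geomT) * geomU_mul + (geomU - 1) * geomT_mul

theorem X_mul_sum_geomU (z : ℕ) :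
    (X : ℚ⟦X⟧) * ∑ j ∈ Finset.range z, geomT * geomU ^ (j + 1) = geomU ^ z - 1 := by
  induction z with
  | zero => simp
  | succ z ih =>
    rw [Finset.sum_range_succ, mul_add, ih]
    linear_combination geomU ^ z * X_mul_geomT_mul_geomU

theorem serCrossed_one (y z : ℕ) :
    serCrossed 1 y z = geomT * geomU ^ z + geomT ^ (z + 1) * (geomT ^ y - 1) := by
  refine family_ext (fun i : ℕ × ℕ => serCrossed 1 i.1 i.2)
    (fun i => geomT * geomU ^ i.2 + geomT ^ (i.2 + 1) * (geomT ^ i.1 - 1))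
    (fun k hk i => ?_) (y, z)
  obtain ⟨y, z⟩ := i
  -- For `x = 1` the first sum of the recurrence is the unknown itself. The last sum involves only
  -- `y = 0`, where the second term of the closed form vanishes.
  have : serCrossed 1 y z - (geomT * geomU ^ z + geomT ^ (z + 1) * (geomT ^ y - 1)) =
      X * ((serCrossed 1 y z - (geomT * geomU ^ z + geomT ^ (z + 1) * (geomT ^ y - 1))) +
        ∑ j ∈ Finset.range z, (serCrossed 1 0 (j + 1) - geomT * geomU ^ (j + 1))) := by
    nth_rw 1 [serCrossed_eq]
    have h : ∑ j ∈ Finset.range y, serAbove (j + 1 + z) =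
        geomT ^ z * ∑ j ∈ Finset.range y, geomT ^ (j + 1) := by
      rw [Finset.mul_sum]
      exact Finset.sum_congr rfl fun j _ => by rw [serAbove_closed]; ring
    rw [Finset.sum_sub_distrib, h]
    simp only [Finset.range_one, Finset.sum_singleton, zero_add]
    linear_combination geomT ^ z * X_mul_sum_geomT y + X_mul_sum_geomU z -
      (geomU ^ z + geomT ^ z * (geomT ^ y - 1)) * geomT_mul
  change X ^ (k + 1) ∣ serCrossed 1 y z - _
  rw [this]
  refine X_pow_succ_dvd_X_mul (dvd_add (hk (y, z)) (Finset.dvd_sum fun j _ => ?_))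
  simpa using hk (0, j + 1)

/-- The closed form of `serCrossed x 0 z`. -/
noncomputable def crossedClosed (x z : ℕ) : ℚ⟦X⟧ :=
  (x : ℚ⟦X⟧) * geomT * geomU ^ z + (geomT ^ x - (x : ℚ⟦X⟧) * geomT +
    X * geomT * (z : ℚ⟦X⟧) * (geomT ^ x - 1 - X * (x : ℚ⟦X⟧) * geomT)) * geomT ^ z

theorem X_mul_sum_serCrossed_one (x z : ℕ) :
    X * ∑ j ∈ Finset.range x, serCrossed 1 j z =
      X * (x : ℚ⟦X⟧) * geomT * (geomU ^ z - geomT ^ z) + geomT ^ z * (geomT ^ x - 1) := by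
  rw [← X_mul_sum_geomT, Finset.mul_sum, Finset.mul_sum, Finset.mul_sum]
  have : X * (x : ℚ⟦X⟧) * geomT * (geomU ^ z - geomT ^ z) =
      ∑ _j ∈ Finset.range x, X * geomT * (geomU ^ z - geomT ^ z) := by
    simp; ring
  rw [this, ← Finset.sum_add_distrib]
  refine Finset.sum_congr rfl fun j _ => ?_
  rw [serCrossed_one]
  ring

theorem X_mul_sum_crossedClosed (x z : ℕ) :
    X * ∑ j ∈ Finset.range z, crossedClosed x (j + 1) = (x : ℚ⟦X⟧) * geomU ^ z - 1 +
      geomT ^ z * (1 - (x : ℚ⟦X⟧) + X * geomT * (z : ℚ⟦X⟧) * (geomT ^ x - 1 - X * (x : ℚ⟦X⟧) * geomT)) := by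
  induction z with
  | zero => simp
  | succ z ih =>
    rw [Finset.sum_range_succ, mul_add, ih, crossedClosed]
    push_cast
    linear_combination (x : ℚ⟦X⟧) * geomU ^ z * X_mul_geomT_mul_geomU +
      ((x : ℚ⟦X⟧) * geomT ^ z - ((x : ℚ⟦X⟧) * geomT * X + 1) * geomT ^ z + geomT ^ (z + 1) * X * ((z : ℚ⟦X⟧) + 1) * (1 + X * (x : ℚ⟦X⟧) * geomT - geomT ^ x)) * geomT_mul

theorem serCrossed_closed (x z : ℕ) : serCrossed x 0 z = crossedClosed x z := by
  refine family_ext (fun z => serCrossed x 0 z) (fun z => crossedClosed x z)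
    (fun k hk z => ?_) z
  have : serCrossed x 0 z - crossedClosed x z =
      X * ∑ j ∈ Finset.range z, (serCrossed x 0 (j + 1) - crossedClosed x (j + 1)) := by
    nth_rw 1 [serCrossed_eq]
    simp only [Finset.range_zero, Finset.sum_empty, add_zero]
    rw [Finset.sum_sub_distrib, crossedClosed]
    linear_combination X_mul_sum_serCrossed_one x z + X_mul_sum_crossedClosed x z -
      (x : ℚ⟦X⟧) * (geomU ^ z - geomT ^ z) * geomT_mul
  change X ^ (k + 1) ∣ serCrossed x 0 z - _
  rw [this]
  exact X_pow_succ_dvd_X_mul (Finset.dvd_sum fun j _ => hk _)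

/-! ### The bilinear form for split states and its geometric sums -/

section
variable {R : Type*} [CommRing R] (t T U V : R)

/-- The coefficient of `a` in `serSplit a 0`. -/
def initSlope : R := t * T ^ 2 * U * (U ^ 2 - T ^ 2)

/-- The constant coefficient in `serSplit a 0`. -/
def initConst : R := T * U * (1 - T ^ 2 + t * initSlope t T U)

/-- The coefficient of `T ^ a` in `splitForm`. -/
def splitGeom (o τ κ : R) : R :=
  U * (t * T * V * o + T ^ 2 * τ + t * T ^ 3 * (κ + τ) - t * T ^ 2 * (1 + t * T) * o)

/-- The coefficient of `a` in `splitForm`. -/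
def splitSlope (o τ υ κ : R) : R :=
  T * (t * initSlope t T U * o + t * T * (U ^ 2 * υ - T ^ 2 * τ) + U * υ -
    T * (τ + t ^ 2 * T ^ 2 * (κ + τ)) - t * (T * U - T ^ 2 - t ^ 2 * T ^ 3) * o)

/-- The constant coefficient in `splitForm`. -/
def splitConst (o τ υ κ : R) : R :=
  T * (t * initConst t T U * o - T ^ 2 * τ + U * υ - t * T ^ 2 * (κ + τ) * (1 + t * T) -
    t * (T * U - T ^ 2 - t ^ 2 * T ^ 3 - t * T ^ 2) * o + t * splitSlope t T U o τ υ κ)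

/-- The bilinear form whose value at `(1, a, T ^ a)` and `(1, T ^ c, U ^ c, c * T ^ c)` is the
generating function `serSplit a c`. -/
def splitForm (i a α o τ υ κ : R) : R :=
  splitConst t T U o τ υ κ * i + splitSlope t T U o τ υ κ * a + splitGeom t T U V o τ κ * α

variable {t T U V}

/-- This is the equation of the split states with `α`, `τ`, `υ` standing for `T ^ a`, `T ^ c`, `U ^
c`, and both crossed sums already evaluated. The factor `V` enters because `a ↦ a + 1` and `c ↦ 0`
together act on the `T ^ a` term at `c = 0` as `tT + t`, and `1 - t - tT = T(1 - 3t + t²)`. -/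
theorem splitForm_rec (hT : T * (1 - t) = 1) (hU : U * (1 - 2 * t) = 1 - t)
    (hV : V * (1 - 3 * t + t ^ 2) = 1) (a c α τ υ : R) :
    splitForm t T U V 1 a α 1 τ υ (c * τ) =
      1 + (t * a * T * (U ^ 2 * υ - T ^ 2 * τ) + T ^ 2 * τ * (α - 1)) +
      t * splitForm t T U V 1 (a + 1) (α * T) 1 τ υ (c * τ) +
      t * splitForm t T U V 1 a α 1 1 1 0 +
      (((a + 1) * (υ * U) - 1 +
        τ * T * (1 - (a + 1) + t * T * (c + 1) * (α * T - 1 - t * (a + 1) * T))) -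
      t * ((a + 1) * T * U +
        (α * T - (a + 1) * T + t * T * (α * T - 1 - t * (a + 1) * T)) * T)) := by
  simp only [splitForm, splitConst, splitSlope, splitGeom, initConst, initSlope]
  grind

theorem splitForm_add_mul_right (i a α o τ υ κ o' τ' υ' κ' : R) :
    splitForm t T U V i a α (o + t * o') (τ + t * τ') (υ + t * υ') (κ + t * κ') =
      splitForm t T U V i a α o τ υ κ + t * splitForm t T U V i a α o' τ' υ' κ' := by
  simp only [splitForm, splitConst, splitSlope, splitGeom]
  ring

/-- The arguments on the left are the sums over `j` of `t ^ j` times `1`, `T ^ (c + j)`, `U ^ (c +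
j)` and `(c + j) * T ^ (c + j)`. Here `1/(1 - tT) = U` and `1/(1 - tU) = (1 - 2t)V`. The identity
splits off the term `j = 0`. -/
theorem splitForm_sum_right (hT : T * (1 - t) = 1) (hU : U * (1 - 2 * t) = 1 - t)
    (hV : V * (1 - 3 * t + t ^ 2) = 1) (i a α c τ υ : R) :
    splitForm t T U V i a α T (U * τ) ((1 - 2 * t) * V * υ) ((c * U + t * T * U ^ 2) * τ) =
      splitForm t T U V i a α 1 τ υ (c * τ) +
      t * splitForm t T U V i a α T (U * (τ * T)) ((1 - 2 * t) * V * (υ * U))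
        (((c + 1) * U + t * T * U ^ 2) * (τ * T)) := by
  have hTU : t * (T * U) = U - 1 := by
    linear_combination (-T) * hU + (U - 1) * hT
  rw [← splitForm_add_mul_right]
  congr 1
  · linear_combination hT
  · linear_combination (-τ) * hTU
  · linear_combination υ * hV - t * V * υ * hU
  · linear_combination (-τ * (c + t * T * U)) * hTU

theorem splitForm_sum_left (hT : T * (1 - t) = 1) (hU : U * (1 - 2 * t) = 1 - t)
    (n α o τ υ κ : R) :
    splitForm t T U V T (T * (n + 1) + t * T ^ 2) (U * α) o τ υ κ =
      splitForm t T U V 1 (n + 1) α o τ υ κ +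
      t * splitForm t T U V T (T * (n + 1 + 1) + t * T ^ 2) (U * (α * T)) o τ υ κ := by
  simp only [splitForm]
  grind

/-- The denominators `d`, `g`, `e` stay opaque while fractions are cleared, and only then become
polynomials in `t`, leaving a polynomial identity. -/
theorem splitForm_total_field {K : Type*} [Field K] (t d g e : K) (hd : d ≠ 0) (hg : g ≠ 0)
    (he : e ≠ 0) (hdt : d = 1 - t) (hgt : g = 1 - 2 * t) (het : e = 1 - 3 * t + t ^ 2) :
    (d⁻¹ + t ^ 2 * splitForm t d⁻¹ (d * g⁻¹) e⁻¹ d⁻¹ (d⁻¹ + t * d⁻¹ ^ 2) (d * g⁻¹ * d⁻¹)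
      d⁻¹ (d * g⁻¹) (g * e⁻¹) (t * d⁻¹ * (d * g⁻¹) ^ 2) - 1) * (g ^ 4 * d ^ 7 * e) =
    t * (1 - 16 * t + 117 * t ^ 2 - 513 * t ^ 3 + 1499 * t ^ 4 - 3074 * t ^ 5 + 4530 * t ^ 6
    - 4827 * t ^ 7 + 3691 * t ^ 8 - 1968 * t ^ 9 + 690 * t ^ 10 - 150 * t ^ 11 + 16 * t ^ 12) := by
  simp only [splitForm, splitConst, splitSlope, splitGeom, initConst, initSlope]
  field_simp
  rw [hdt, hgt, het]
  ring

end

/-! ### Closed forms for the split and increasing states, and the final fraction -/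

theorem serSplit_closed (a c : ℕ) :
    serSplit a c = splitForm X geomT geomU geomV 1 (a : ℚ⟦X⟧) (geomT ^ a) 1 (geomT ^ c)
      (geomU ^ c) ((c : ℚ⟦X⟧) * geomT ^ c) := by
  let F : ℕ × ℕ → ℚ⟦X⟧ := fun i => splitForm X geomT geomU geomV 1 (i.1 : ℚ⟦X⟧) (geomT ^ i.1) 1
    (geomT ^ i.2) (geomU ^ i.2) ((i.2 : ℚ⟦X⟧) * geomT ^ i.2)
  refine family_ext (fun i : ℕ × ℕ => serSplit i.1 i.2) F (fun k hk i => ?_) (a, c)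
  obtain ⟨a, c⟩ := i
  -- The sum starts at `z = 2`, so the term `z = 1` is added and subtracted to reach the known sum
  -- from `z = 1`.
  have hsum : X * ∑ j ∈ Finset.range c, serCrossed (a + 1) 0 (j + 2) =
      X * ∑ j ∈ Finset.range (c + 1), crossedClosed (a + 1) (j + 1) -
        X * crossedClosed (a + 1) 1 := by
    rw [Finset.sum_range_succ', mul_add]
    simp [serCrossed_closed, add_assoc]
  have h1 := X_mul_sum_serCrossed_one a (c + 2)
  have h2 := X_mul_sum_crossedClosed (a + 1) (c + 1)
  have h3 := splitForm_rec geomT_mul geomU_mul geomV_mul (a : ℚ⟦X⟧) c (geomT ^ a) (geomT ^ c)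
    (geomU ^ c)
  have : serSplit a c - F (a, c) = X * ((serSplit (a + 1) c - F (a + 1, c)) +
      (serSplit a 0 - F (a, 0))) := by
    rw [serSplit_eq, mul_add, mul_add, mul_add, hsum, h1, h2, crossedClosed]
    simp only [F, pow_zero, Nat.cast_zero, zero_mul]
    rw [h3]
    push_cast
    rw [pow_succ geomT a]
    ring
  change X ^ (k + 1) ∣ serSplit a c - F (a, c)
  rw [this]
  exact X_pow_succ_dvd_X_mul (dvd_add (hk (a + 1, c)) (hk (a, 0)))

/-- The closed form of `∑ j, X ^ j * serSplit (v + 1) (c + j)`. -/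
noncomputable def splitSum (v c : ℕ) : ℚ⟦X⟧ :=
  splitForm X geomT geomU geomV 1 ((v : ℚ⟦X⟧) + 1) (geomT ^ (v + 1)) geomT (geomU * geomT ^ c)
    ((1 - 2 * X) * geomV * geomU ^ c) (((c : ℚ⟦X⟧) * geomU + X * geomT * geomU ^ 2) * geomT ^ c)

theorem splitSum_eq (v c : ℕ) :
    splitSum v c = serSplit (v + 1) c + X * splitSum v (c + 1) := by
  have h := splitForm_sum_right geomT_mul geomU_mul geomV_mul 1 ((v : ℚ⟦X⟧) + 1)
    (geomT ^ (v + 1)) c (geomT ^ c) (geomU ^ c)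
  rw [serSplit_closed, splitSum, h, splitSum]
  push_cast
  simp only [pow_succ]

/-- The closed form of `∑ j, X ^ j * splitSum (n + j) 0`. -/
noncomputable def splitSumSum (n : ℕ) : ℚ⟦X⟧ :=
  splitForm X geomT geomU geomV geomT (geomT * ((n : ℚ⟦X⟧) + 1) + X * geomT ^ 2)
    (geomU * geomT ^ (n + 1)) geomT geomU ((1 - 2 * X) * geomV) (X * geomT * geomU ^ 2)

theorem splitSumSum_eq (n : ℕ) :
    splitSumSum n = splitSum n 0 + X * splitSumSum (n + 1) := by
  have h := splitForm_sum_left (V := geomV) geomT_mul geomU_mul (n : ℚ⟦X⟧) (geomT ^ (n + 1))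
    geomT geomU ((1 - 2 * X) * geomV) (X * geomT * geomU ^ 2)
  rw [splitSumSum, h, splitSum, splitSumSum]
  push_cast
  simp only [pow_zero, mul_one, zero_mul, zero_add, pow_succ]

/-- Unrolling the recurrence gives a double sum over the increasing length `n + k` and the value
`v`. Summing over `k` first gives `splitSum v (n - 1 - v)` if `v < n`, and `X ^ (j + 1) * splitSum
(n + j) 0` if `v = n + j`, since such a `v` is available only from `k = j + 1` on. -/
theorem serIncr_closed (n : ℕ) :
    serIncr n = geomT + X * (∑ v ∈ Finset.range n, splitSum v (n - 1 - v) +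
      X * splitSumSum n) := by
  refine family_ext serIncr (fun n => geomT + X * (∑ v ∈ Finset.range n, splitSum v (n - 1 - v) +
      X * splitSumSum n)) (fun k hk n => ?_) n
  have hsum : ∑ v ∈ Finset.range n, splitSum v (n - 1 - v) =
      ∑ v ∈ Finset.range n, serSplit (v + 1) (n - 1 - v) +
        X * ∑ v ∈ Finset.range n, splitSum v (n - v) := by
    rw [Finset.mul_sum, ← Finset.sum_add_distrib]
    refine Finset.sum_congr rfl fun v hv => ?_
    have : n - v = n - 1 - v + 1 := by have := Finset.mem_range.1 hv; omega
    rw [splitSum_eq, this]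
  have hsucc : ∑ v ∈ Finset.range (n + 1), splitSum v (n + 1 - 1 - v) =
      ∑ v ∈ Finset.range n, splitSum v (n - v) + splitSum n 0 := by
    simp [Finset.sum_range_succ]
  have : serIncr n - (geomT + X * (∑ v ∈ Finset.range n, splitSum v (n - 1 - v) +
      X * splitSumSum n)) = X * (serIncr (n + 1) - (geomT +
        X * (∑ v ∈ Finset.range (n + 1), splitSum v (n + 1 - 1 - v) +
          X * splitSumSum (n + 1)))) := by
    rw [serIncr_eq, hsum, hsucc, splitSumSum_eq n]
    linear_combination -geomT_mul
  change X ^ (k + 1) ∣ serIncr n - (geomT + _)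
  rw [this]
  exact X_pow_succ_dvd_X_mul (hk (n + 1))

theorem serIncr_zero_sub_one :
    serIncr 0 - 1 = X * p * ((1 - 2 * X) ^ 4 * (1 - X) ^ 7 * (1 - 3 * X + X ^ 2) : ℚ⟦X⟧)⁻¹ := by
  rw [PowerSeries.eq_mul_inv_iff_mul_eq (by simp), serIncr_closed]
  -- In the fraction field `T`, `U`, `V` become honest quotients, so the field identity applies.
  apply IsFractionRing.injective ℚ⟦X⟧ (FractionRing ℚ⟦X⟧)
  set φ := algebraMap ℚ⟦X⟧ (FractionRing ℚ⟦X⟧)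
  have hT : φ geomT * (1 - φ X) = 1 := by
    simpa [map_ofNat] using congrArg φ geomT_mul
  have hU : φ geomU * (1 - 2 * φ X) = 1 - φ X := by
    simpa [map_ofNat] using congrArg φ geomU_mul
  have hV : φ geomV * (1 - 3 * φ X + φ X ^ 2) = 1 := by
    simpa [map_ofNat] using congrArg φ geomV_mul
  have hd : 1 - φ X ≠ 0 := right_ne_zero_of_mul_eq_one hT
  have he : 1 - 3 * φ X + φ X ^ 2 ≠ 0 := right_ne_zero_of_mul_eq_one hV
  have hg : 1 - 2 * φ X ≠ 0 := fun h => hd (by rw [← hU, h, mul_zero])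
  have key := splitForm_total_field (φ X) _ _ _ hd hg he rfl rfl rfl
  rw [← eq_inv_of_mul_eq_one_left hT, ← eq_inv_of_mul_eq_one_left hV, ← div_eq_mul_inv,
    ← eq_div_of_mul_eq hg hU] at key
  simp only [splitSumSum, splitForm, splitConst, splitSlope, splitGeom, initConst, initSlope,
    Finset.range_zero, Finset.sum_empty, p, map_mul, map_add, map_sub, map_pow, map_one,
    map_ofNat, Nat.cast_zero, map_zero] at key ⊢
  linear_combination key

/-! ### From states to counts of active sites -/

/-- The least inversion top (the length if there is none) after inserting `v`. -/
def nextTop (m v : ℕ) : ℕ := if v ≤ m then v + 1 else m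

/-- One more than the greatest inversion bottom (`0` if there is none) after inserting `v` into a
permutation of length `n`. -/
def nextBot (n D v : ℕ) : ℕ := if v = n then D else max D v + 1

/-- The gap before the insertion of `v` that contains the gap `g` after it. -/
def oldGap (v g : ℕ) : ℕ := if g ≤ v then g else g - 1

/-- The active sites after inserting `v`. -/
def nextSites (n m D v : ℕ) (S : Finset ℕ) : Finset ℕ :=
  {g ∈ Finset.range (n + 2) | oldGap v g ∈ S ∧ (v < D → v < g) ∧ ¬ (m < g ∧ g ≤ v)}

/-- The number of descendants after `k` steps of a permutation of length `n` with least inversion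
top `m`, greatest inversion bottom `D - 1` and active sites `S`. -/
def cntState : ℕ → ℕ → ℕ → ℕ → Finset ℕ → ℕ
  | 0, _, _, _, _ => 1
  | k + 1, n, m, D, S =>
    ∑ v ∈ S, cntState k (n + 1) (nextTop m v) (nextBot n D v) (nextSites n m D v S)

/-- Each site is indexed by the number of sites above it, so sums over sites depend only on how many
there are. -/
theorem sum_card_filter_lt (A : Finset ℕ) (f : ℕ → ℕ) :
    ∑ v ∈ A, f (Finset.card {g ∈ A | v < g}) = ∑ j ∈ Finset.range A.card, f j := by
  induction A using Finset.induction_on_min with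
  | empty => simp
  | insert a s has ih =>
    have ha : a ∉ s := fun h => lt_irrefl _ (has a h)
    rw [Finset.sum_insert ha, Finset.card_insert_of_notMem ha, Finset.sum_range_succ, add_comm, ← ih]
    congr 1
    · refine Finset.sum_congr rfl fun v hv => ?_
      rw [Finset.filter_insert, if_neg (has v hv).le.not_gt]
    · rw [Finset.filter_insert, if_neg (lt_irrefl a), Finset.filter_true_of_mem has]

theorem card_filter_congr {S : Finset ℕ} {P Q : ℕ → Prop} [DecidablePred P] [DecidablePred Q]
    (h : ∀ g ∈ S, P g ↔ Q g) : Finset.card {g ∈ S | P g} = Finset.card {g ∈ S | Q g} := by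
  rw [Finset.filter_congr h]

theorem card_filter_eq_zero {S : Finset ℕ} {P : ℕ → Prop} [DecidablePred P]
    (h : ∀ g ∈ S, ¬ P g) : Finset.card {g ∈ S | P g} = 0 := by
  rw [Finset.filter_false_of_mem h, Finset.card_empty]

theorem card_filter_eq_one {S : Finset ℕ} {P : ℕ → Prop} [DecidablePred P] {v : ℕ} (hv : v ∈ S)
    (h : ∀ g ∈ S, P g ↔ g = v) : Finset.card {g ∈ S | P g} = 1 := by
  rw [Finset.filter_congr h, Finset.filter_eq', if_pos hv, Finset.card_singleton]

theorem card_filter_eq_add {S : Finset ℕ} {P Q R : ℕ → Prop} [DecidablePred P] [DecidablePred Q]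
    [DecidablePred R] (h : ∀ g ∈ S, (P g ↔ Q g ∨ R g) ∧ ¬ (Q g ∧ R g)) :
    Finset.card {g ∈ S | P g} = Finset.card {g ∈ S | Q g} + Finset.card {g ∈ S | R g} := by
  rw [Finset.filter_congr fun g hg => (h g hg).1, Finset.filter_or, Finset.card_union_of_disjoint]
  exact Finset.disjoint_filter.2 fun g hg h1 h2 => (h g hg).2 ⟨h1, h2⟩

theorem mem_nextSites {n m D v g : ℕ} {S : Finset ℕ} (hS : ∀ g ∈ S, g ≤ n) (hv : v ≤ n) :
    g ∈ nextSites n m D v S ↔ (g ∈ S ∧ g ≤ v ∧ D ≤ v ∧ g ≤ m) ∨ ∃ h ∈ S, v ≤ h ∧ g = h + 1 := by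
  rw [nextSites, Finset.mem_filter, Finset.mem_range, oldGap]
  split_ifs with hg
  · constructor
    · rintro ⟨-, h1, h2, h3⟩
      exact Or.inl ⟨h1, hg, by omega, by omega⟩
    · rintro (⟨h1, h2, h3, h4⟩ | ⟨h, h1, h2, h3⟩)
      · exact ⟨by omega, h1, by omega, by omega⟩
      · omega
  · constructor
    · rintro ⟨-, h1, h2, h3⟩
      exact Or.inr ⟨_, h1, by omega, by omega⟩
    · rintro (⟨h1, h2, h3, h4⟩ | ⟨h, h1, h2, rfl⟩)
      · omega
      · have := hS h h1
        exact ⟨by omega, by simpa using h1, by omega, by omega⟩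

theorem le_of_mem_nextSites {n m D v : ℕ} {S : Finset ℕ} :
    ∀ g ∈ nextSites n m D v S, g ≤ n + 1 := by
  intro g hg
  have := Finset.mem_range.1 (Finset.mem_filter.1 hg).1
  omega

theorem succ_mem_nextSites {n m D v : ℕ} {S : Finset ℕ} (hS : ∀ g ∈ S, g ≤ n) (hn : n ∈ S)
    (hv : v ∈ S) : n + 1 ∈ nextSites n m D v S :=
  (mem_nextSites hS (hS v hv)).2 (Or.inr ⟨n, hn, hS v hv, rfl⟩)

theorem card_filter_nextSites {n m D v : ℕ} {S : Finset ℕ} (hS : ∀ g ∈ S, g ≤ n) (hv : v ∈ S)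
    (P : ℕ → Prop) [DecidablePred P] :
    Finset.card {g ∈ nextSites n m D v S | P g} =
      Finset.card {g ∈ S | g ≤ v ∧ D ≤ v ∧ g ≤ m ∧ P g} +
        Finset.card {g ∈ S | v ≤ g ∧ P (g + 1)} := by
  rw [← Finset.card_map (s := {g ∈ S | v ≤ g ∧ P (g + 1)}) ⟨Nat.succ, Nat.succ_injective⟩,
    ← Finset.card_union_of_disjoint]
  · congr 1
    ext g
    simp only [Finset.mem_filter, mem_nextSites hS (hS v hv), Finset.mem_union, Finset.mem_map,
      Function.Embedding.coeFn_mk, Nat.succ_eq_add_one]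
    constructor
    · rintro ⟨⟨h1, h2, h3, h4⟩ | ⟨h, h1, h2, rfl⟩, h5⟩
      · exact Or.inl ⟨h1, h2, h3, h4, h5⟩
      · exact Or.inr ⟨h, ⟨h1, h2, h5⟩, rfl⟩
    · rintro (⟨h1, h2, h3, h4, h5⟩ | ⟨h, ⟨h1, h2, h5⟩, rfl⟩)
      · exact ⟨Or.inl ⟨h1, h2, h3, h4⟩, h5⟩
      · exact ⟨Or.inr ⟨h, h1, h2, rfl⟩, h5⟩
  · rw [Finset.disjoint_left]
    intro g hg
    simp only [Finset.mem_filter, Finset.mem_map, Function.Embedding.coeFn_mk,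
      Nat.succ_eq_add_one, not_exists, not_and] at hg ⊢
    rintro h ⟨-, h1, -⟩ rfl
    omega

theorem card_filter_nextSites_low {n m D v : ℕ} {S : Finset ℕ} (hS : ∀ g ∈ S, g ≤ n) (hv : v ∈ S)
    {P Q : ℕ → Prop} [DecidablePred P] [DecidablePred Q] (h0 : ∀ g ∈ S, ¬ (v ≤ g ∧ P (g + 1)))
    (h : ∀ g ∈ S, (g ≤ v ∧ D ≤ v ∧ g ≤ m ∧ P g) ↔ Q g) :
    Finset.card {g ∈ nextSites n m D v S | P g} = Finset.card {g ∈ S | Q g} := by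
  rw [card_filter_nextSites hS hv, card_filter_eq_zero h0, add_zero, card_filter_congr h]

theorem card_filter_nextSites_high {n m D v : ℕ} {S : Finset ℕ} (hS : ∀ g ∈ S, g ≤ n)
    (hv : v ∈ S) {P Q : ℕ → Prop} [DecidablePred P] [DecidablePred Q]
    (h0 : ∀ g ∈ S, ¬ (g ≤ v ∧ D ≤ v ∧ g ≤ m ∧ P g)) (h : ∀ g ∈ S, (v ≤ g ∧ P (g + 1)) ↔ Q g) :
    Finset.card {g ∈ nextSites n m D v S | P g} = Finset.card {g ∈ S | Q g} := by
  rw [card_filter_nextSites hS hv, card_filter_eq_zero h0, zero_add, card_filter_congr h]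

theorem card_filter_nextSites_zero {n m D v : ℕ} {S : Finset ℕ} (hS : ∀ g ∈ S, g ≤ n)
    (hv : v ∈ S) {P : ℕ → Prop} [DecidablePred P] (h : ∀ g ∈ S, ¬ (g ≤ v ∧ D ≤ v ∧ g ≤ m ∧ P g))
    (h' : ∀ g ∈ S, ¬ (v ≤ g ∧ P (g + 1))) : Finset.card {g ∈ nextSites n m D v S | P g} = 0 := by
  rw [card_filter_nextSites hS hv, card_filter_eq_zero h, card_filter_eq_zero h']

theorem card_filter_eq_add_one {S : Finset ℕ} {P Q : ℕ → Prop} [DecidablePred P] [DecidablePred Q]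
    {v : ℕ} (hv : v ∈ S) (h : ∀ g ∈ S, (P g ↔ Q g ∨ g = v)) (hQ : ¬ Q v) :
    Finset.card {g ∈ S | P g} = Finset.card {g ∈ S | Q g} + 1 := by
  rw [card_filter_eq_add (Q := Q) (R := fun g => g = v) fun g hg =>
    ⟨h g hg, fun h1 => hQ (h1.2 ▸ h1.1)⟩, card_filter_eq_one hv fun g _ => Iff.rfl]

/-- Every site up to `v` lies in `(m, v]` and dies. The sites from `v` on survive, shifted by one,
and `m` does not change. -/
theorem cntState_above (k : ℕ) {n m D : ℕ} {S : Finset ℕ} (hS : ∀ g ∈ S, g ≤ n)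
    (hm : ∀ g ∈ S, m < g) : cntState k n m D S = cntAbove k S.card := by
  induction k generalizing n D S with
  | zero => rfl
  | succ k ih =>
    rw [cntState, cntAbove, ← sum_card_filter_lt]
    refine Finset.sum_congr rfl fun v hv => ?_
    have hmv := hm v hv
    rw [nextTop, if_neg hmv.not_ge, ih le_of_mem_nextSites]
    · congr 1
      rw [← card_filter_eq_add_one (P := fun g => v ≤ g) hv (fun g hg => by omega) (lt_irrefl v),
        ← card_filter_nextSites_high (m := m) (D := D) (P := fun _ => True) (Q := fun g => v ≤ g)
          hS hv (fun g hg => by have := hm g hg; omega) (fun g hg => by simp), Finset.filter_true]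
    · intro g hg
      rw [mem_nextSites hS (hS v hv)] at hg
      obtain ⟨h1, h2, h3, h4⟩ | ⟨h, h1, h2, rfl⟩ := hg
      · have := hm g h1
        omega
      · omega

/-- If `v ≤ m`, all sites up to `v` die and `v + 1` is the only one not above the new top. If `m < v
< D`, only sites above `m` remain. If `D ≤ v`, the sites up to `m` survive and `(m, v]` is emptied.
-/
theorem cntState_crossed (k : ℕ) {n m D : ℕ} {S : Finset ℕ} (hS : ∀ g ∈ S, g ≤ n) (hn : n ∈ S)
    (hmD : m < D) (hDn : D ≤ n) :
    cntState k n m D S = cntCrossed k (Finset.card {g ∈ S | g ≤ m})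
      (Finset.card {g ∈ S | m < g ∧ g < D}) (Finset.card {g ∈ S | D ≤ g}) := by
  induction k generalizing n m D S with
  | zero => rfl
  | succ k ih =>
    have hsplit : S = {g ∈ S | g ≤ m} ∪ {g ∈ S | m < g ∧ g < D} ∪ {g ∈ S | D ≤ g} := by
      ext g
      simp only [Finset.mem_union, Finset.mem_filter, ← and_or_left]
      exact ⟨fun h => ⟨h, by omega⟩, fun h => h.1⟩
    rw [cntState, cntCrossed, ← sum_card_filter_lt, ← sum_card_filter_lt, ← sum_card_filter_lt]
    conv_lhs => rw [hsplit]
    rw [Finset.sum_union (Finset.disjoint_left.2 fun g h1 h2 => by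
        simp only [Finset.mem_union, Finset.mem_filter] at h1 h2; omega),
      Finset.sum_union (Finset.disjoint_left.2 fun g h1 h2 => by
        simp only [Finset.mem_filter] at h1 h2; omega)]
    simp only [← hsplit]
    congr 1
    · congr 1
      · refine Finset.sum_congr rfl fun v hv => ?_
        obtain ⟨hv, hvm⟩ := Finset.mem_filter.1 hv
        have hx : Finset.card {g ∈ nextSites n m D v S | g ≤ v + 1} = 1 := by
          rw [card_filter_nextSites_high (Q := fun g => g = v) hS hv (fun g hg => by omega)
            (fun g hg => by omega), card_filter_eq_one hv fun g _ => Iff.rfl]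
        have hy : Finset.card {g ∈ nextSites n m D v S | v + 1 < g ∧ g < D + 1} =
            Finset.card {g ∈ S | g ≤ m ∧ v < g} + Finset.card {g ∈ S | m < g ∧ g < D} := by
          rw [card_filter_nextSites_high (Q := fun g => v < g ∧ g < D) hS hv
            (fun g hg => by omega) (fun g hg => by omega)]
          exact card_filter_eq_add fun g hg => by omega
        have hz : Finset.card {g ∈ nextSites n m D v S | D + 1 ≤ g} =
            Finset.card {g ∈ S | D ≤ g} :=
          card_filter_nextSites_high hS hv (fun g hg => by omega) (fun g hg => by omega)
        rw [nextTop, if_pos hvm, nextBot, if_neg (by omega), max_eq_left (by omega),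
          ih le_of_mem_nextSites (succ_mem_nextSites hS hn hv) (by omega) (by omega),
          hx, hy, hz, Finset.filter_filter]
      · refine Finset.sum_congr rfl fun v hv => ?_
        obtain ⟨hv, hvm, hvD⟩ := Finset.mem_filter.1 hv
        rw [nextTop, if_neg (by omega), cntState_above k le_of_mem_nextSites]
        · congr 1
          have h : Finset.card {g ∈ nextSites n m D v S | True} =
              Finset.card {g ∈ S | v < g} + 1 := by
            rw [card_filter_nextSites_high (P := fun _ => True) (Q := fun g => v ≤ g) hS hv
              (fun g hg => by omega) (fun g hg => by simp)]
            exact card_filter_eq_add_one hv (fun g hg => by omega) (lt_irrefl v)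
          rw [Finset.filter_true, card_filter_eq_add (Q := fun g => (m < g ∧ g < D) ∧ v < g)
            (R := fun g => D ≤ g) (fun g hg => by omega)] at h
          rw [h, Finset.filter_filter]
          omega
        · intro g hg
          rw [mem_nextSites hS (hS v hv)] at hg
          obtain ⟨h1, h2, h3, h4⟩ | ⟨h, h1, h2, rfl⟩ := hg <;> omega
    · refine Finset.sum_congr rfl fun v hv => ?_
      obtain ⟨hv, hvD⟩ := Finset.mem_filter.1 hv
      have hvn := hS v hv
      -- These bounds suffice for both `v = n` and `v < n`: no active site lies in `(m, v]`, so the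
      -- exact new bottom does not affect the counts.
      have hbot : nextBot n D v ≤ v + 1 ∧ D ≤ nextBot n D v := by
        rw [nextBot]; split_ifs <;> omega
      have hx : Finset.card {g ∈ nextSites n m D v S | g ≤ m} = Finset.card {g ∈ S | g ≤ m} :=
        card_filter_nextSites_low hS hv (fun g hg => by omega) (fun g hg => by omega)
      have hy : Finset.card {g ∈ nextSites n m D v S | m < g ∧ g < nextBot n D v} = 0 :=
        card_filter_nextSites_zero hS hv (fun g hg => by omega) (fun g hg => by omega)
      have hz : Finset.card {g ∈ nextSites n m D v S | nextBot n D v ≤ g} =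
          Finset.card {g ∈ S | D ≤ g ∧ v < g} + 1 := by
        rw [card_filter_nextSites_high (P := fun g => nextBot n D v ≤ g) (Q := fun g => v ≤ g)
          hS hv (fun g hg => by omega) (fun g hg => by omega)]
        exact card_filter_eq_add_one hv (fun g hg => by omega) (by omega)
      rw [nextTop, if_neg (by omega), ih le_of_mem_nextSites (succ_mem_nextSites hS hn hv)
        (by omega) (by omega), hx, hy, hz, Finset.filter_filter]

theorem cntState_split (k : ℕ) {n m D c : ℕ} {S : Finset ℕ} (hS : ∀ g ∈ S, g ≤ n) (hn : n ∈ S)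
    (hDm : D ≤ m) (hmn : m < n) (hb : Finset.card {g ∈ S | D ≤ g ∧ g ≤ m} = 1)
    (hc : Finset.card {g ∈ S | m < g} = c + 1) :
    cntState k n m D S = cntSplit k (Finset.card {g ∈ S | g < D}) c := by
  induction k generalizing n m D S c with
  | zero => rfl
  | succ k ih =>
    obtain ⟨b, hbS⟩ := Finset.card_eq_one.1 hb
    have hbmem : b ∈ S ∧ D ≤ b ∧ b ≤ m := by
      have : b ∈ ({g ∈ S | D ≤ g ∧ g ≤ m} : Finset ℕ) := by rw [hbS, Finset.mem_singleton]
      exact Finset.mem_filter.1 this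
    have hbeq : ∀ g ∈ S, (D ≤ g ∧ g ≤ m) ↔ g = b := fun g hg => by
      rw [← Finset.mem_singleton, ← hbS, Finset.mem_filter, and_iff_right hg]
    obtain ⟨hbS', hDb, hbm⟩ := hbmem
    have hle : Finset.card {g ∈ S | g ≤ m} = Finset.card {g ∈ S | g < D} + 1 :=
      card_filter_eq_add_one hbS' (fun g hg => by have := hbeq g hg; omega) (by omega)
    have hge : Finset.card {g ∈ S | D ≤ g} = c + 2 := by
      rw [card_filter_eq_add_one (Q := fun g => m < g) hbS'
        (fun g hg => by have := hbeq g hg; omega) (by omega), hc]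
    have hsplit : S = {g ∈ S | g < D} ∪ {b} ∪ {g ∈ S | m < g} := by
      ext g
      simp only [Finset.mem_union, Finset.mem_filter, Finset.mem_singleton]
      constructor
      · intro h
        have := hbeq g h
        by_cases h1 : g < D
        · exact Or.inl (Or.inl ⟨h, h1⟩)
        · by_cases h2 : m < g
          · exact Or.inr ⟨h, h2⟩
          · exact Or.inl (Or.inr (this.1 (by omega)))
      · rintro ((h | rfl) | h)
        exacts [h.1, hbS', h.1]
    rw [cntState, cntSplit, add_assoc (_ + _)]
    conv_lhs => rw [hsplit]
    rw [Finset.sum_union (Finset.disjoint_left.2 fun g h1 h2 => by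
        simp only [Finset.mem_union, Finset.mem_filter, Finset.mem_singleton] at h1 h2; omega),
      Finset.sum_union (Finset.disjoint_left.2 fun g h1 h2 => by
        simp only [Finset.mem_filter, Finset.mem_singleton] at h1 h2; omega),
      Finset.sum_singleton]
    simp only [← hsplit]
    congr 1
    · congr 1
      · rw [← sum_card_filter_lt]
        refine Finset.sum_congr rfl fun v hv => ?_
        obtain ⟨hv, hvD⟩ := Finset.mem_filter.1 hv
        have hx : Finset.card {g ∈ nextSites n m D v S | g ≤ v + 1} = 1 := by
          rw [card_filter_nextSites_high (Q := fun g => g = v) hS hv (fun g hg => by omega)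
            (fun g hg => by omega), card_filter_eq_one hv fun g _ => Iff.rfl]
        have hy : Finset.card {g ∈ nextSites n m D v S | v + 1 < g ∧ g < D + 1} =
            Finset.card {g ∈ S | g < D ∧ v < g} :=
          card_filter_nextSites_high hS hv (fun g hg => by omega) (fun g hg => by omega)
        have hz : Finset.card {g ∈ nextSites n m D v S | D + 1 ≤ g} = c + 2 := by
          rw [card_filter_nextSites_high (Q := fun g => D ≤ g) hS hv (fun g hg => by omega)
            (fun g hg => by omega), hge]
        rw [nextTop, if_pos (by omega), nextBot, if_neg (by omega), max_eq_left (by omega),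
          cntState_crossed k le_of_mem_nextSites (succ_mem_nextSites hS hn hv) (by omega)
          (by omega), hx, hy, hz, Finset.filter_filter]
      · have hx : Finset.card {g ∈ nextSites n m D b S | g < b + 1} =
            Finset.card {g ∈ S | g < D} + 1 := by
          rw [← hle]
          exact card_filter_nextSites_low hS hbS' (fun g hg => by omega)
            (fun g hg => by have := hbeq g hg; omega)
        have hy : Finset.card {g ∈ nextSites n m D b S | b + 1 ≤ g ∧ g ≤ b + 1} = 1 := by
          rw [card_filter_nextSites_high (Q := fun g => g = b) hS hbS' (fun g hg => by omega)
            (fun g hg => by omega), card_filter_eq_one hbS' fun g _ => Iff.rfl]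
        have hz : Finset.card {g ∈ nextSites n m D b S | b + 1 < g} = c + 1 := by
          rw [card_filter_nextSites_high (Q := fun g => m < g) hS hbS' (fun g hg => by omega)
            (fun g hg => by have := hbeq g hg; omega), hc]
        rw [nextTop, if_pos (by omega), nextBot, if_neg (by omega), max_eq_right (by omega),
          ih le_of_mem_nextSites (succ_mem_nextSites hS hn hbS') le_rfl (by omega) hy hz, hx]
    · have hsum := sum_card_filter_lt {g ∈ S | m < g} fun j =>
        if j = 0 then cntSplit k (Finset.card {g ∈ S | g < D}) 0 else
          cntCrossed k (Finset.card {g ∈ S | g < D} + 1) 0 (j + 1)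
      rw [hc, Finset.sum_range_succ', add_comm (Finset.sum _ _)] at hsum
      simp only [if_true, Nat.add_eq_zero_iff, one_ne_zero, and_false, if_false] at hsum
      rw [← hsum]
      refine Finset.sum_congr rfl fun v hv => ?_
      obtain ⟨hv, hvm⟩ := Finset.mem_filter.1 hv
      have hvn := hS v hv
      rw [Finset.filter_filter, nextTop, if_neg (by omega)]
      split_ifs with h0
      · have hvn : v = n := by
          by_contra hne
          have : n ∈ ({g ∈ S | m < g ∧ v < g} : Finset ℕ) :=
            Finset.mem_filter.2 ⟨hn, hmn, by omega⟩
          rw [Finset.card_eq_zero.1 h0] at this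
          exact Finset.notMem_empty _ this
        have hx : Finset.card {g ∈ nextSites n m D v S | g < D} =
            Finset.card {g ∈ S | g < D} :=
          card_filter_nextSites_low hS hv (fun g hg => by omega) (fun g hg => by omega)
        have hy : Finset.card {g ∈ nextSites n m D v S | D ≤ g ∧ g ≤ m} = 1 := by
          rw [← hb]
          exact card_filter_nextSites_low hS hv (fun g hg => by omega) (fun g hg => by omega)
        have hz : Finset.card {g ∈ nextSites n m D v S | m < g} = 0 + 1 := by
          rw [card_filter_nextSites_high (Q := fun g => g = v) hS hv (fun g hg => by omega)
            (fun g hg => by have := hS g hg; omega), card_filter_eq_one hv fun g _ => Iff.rfl]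
        rw [nextBot, if_pos hvn,
          ih le_of_mem_nextSites (succ_mem_nextSites hS hn hv) hDm (by omega) hy hz, hx]
      · have hvn : v ≠ n := by
          rintro rfl
          exact h0 (card_filter_eq_zero fun g hg => by have := hS g hg; omega)
        have hx : Finset.card {g ∈ nextSites n m D v S | g ≤ m} =
            Finset.card {g ∈ S | g < D} + 1 := by
          rw [← hle]
          exact card_filter_nextSites_low hS hv (fun g hg => by omega) (fun g hg => by omega)
        have hy : Finset.card {g ∈ nextSites n m D v S | m < g ∧ g < v + 1} = 0 :=
          card_filter_nextSites_zero hS hv (fun g hg => by omega) (fun g hg => by omega)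
        have hz : Finset.card {g ∈ nextSites n m D v S | v + 1 ≤ g} =
            Finset.card {g ∈ S | m < g ∧ v < g} + 1 := by
          rw [card_filter_nextSites_high (Q := fun g => v ≤ g) hS hv (fun g hg => by omega)
            (fun g hg => by omega)]
          exact card_filter_eq_add_one hv (fun g hg => by omega) (by omega)
        rw [nextBot, if_neg hvn, max_eq_right (by omega),
          cntState_crossed k le_of_mem_nextSites (succ_mem_nextSites hS hn hv) (by omega)
          (by omega), hx, hy, hz]

theorem cntState_incr (k n : ℕ) :
    cntState k n n 0 (Finset.range (n + 1)) = cntIncr k n := by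
  induction k generalizing n with
  | zero => rfl
  | succ k ih =>
    have hS : ∀ g ∈ Finset.range (n + 1), g ≤ n := fun g hg => by
      have := Finset.mem_range.1 hg; omega
    have hn : n ∈ Finset.range (n + 1) := Finset.self_mem_range_succ n
    rw [cntState, cntIncr, Finset.sum_range_succ, add_comm]
    congr 1
    · have : nextSites n n 0 n (Finset.range (n + 1)) = Finset.range (n + 2) := by
        ext g
        rw [mem_nextSites hS le_rfl, Finset.mem_range, Finset.mem_range]
        constructor
        · rintro (h | ⟨h, h1, h2, rfl⟩)
          · omega
          · have := hS h h1
            omega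
        · intro h
          rcases Nat.lt_or_ge n g with h1 | h1
          · exact Or.inr ⟨n, hn, le_rfl, by omega⟩
          · exact Or.inl (by omega)
      rw [nextTop, if_pos le_rfl, nextBot, if_pos rfl, this, ih]
    · refine Finset.sum_congr rfl fun v hv => ?_
      have hvn := Finset.mem_range.1 hv
      have hv : v ∈ Finset.range (n + 1) := Finset.mem_range.2 (by omega)
      have hx : Finset.card {g ∈ nextSites n n 0 v (Finset.range (n + 1)) | g < v + 1} = v + 1 := by
        rw [card_filter_nextSites_low (Q := fun g => g ∈ Finset.range (v + 1)) hS hv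
          (fun g hg => by omega) (fun g hg => by rw [Finset.mem_range]; omega),
          Finset.filter_mem_eq_inter, Finset.inter_eq_right.2
          (Finset.range_mono (by omega)), Finset.card_range]
      have hy : Finset.card {g ∈ nextSites n n 0 v (Finset.range (n + 1)) |
          v + 1 ≤ g ∧ g ≤ v + 1} = 1 := by
        rw [card_filter_nextSites_high (Q := fun g => g = v) hS hv (fun g hg => by omega)
          (fun g hg => by omega), card_filter_eq_one hv fun g _ => Iff.rfl]
      have hz : Finset.card {g ∈ nextSites n n 0 v (Finset.range (n + 1)) | v + 1 < g} =
          n - 1 - v + 1 := by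
        rw [card_filter_nextSites_high (Q := fun g => g ∈ Finset.Icc (v + 1) n) hS hv
          (fun g hg => by omega)
          (fun g hg => by have := hS g hg; rw [Finset.mem_Icc]; omega),
          Finset.filter_mem_eq_inter, Finset.inter_eq_right.2 fun g hg => by
            rw [Finset.mem_Icc] at hg; exact Finset.mem_range.2 (by omega), Nat.card_Icc]
        omega
      rw [nextTop, if_pos hvn.le, nextBot, if_neg hvn.ne, max_eq_right (Nat.zero_le v),
        cntState_split k le_of_mem_nextSites (succ_mem_nextSites hS hn hv) le_rfl (by omega)
        hy hz, hx]

/-! ### Appending a value, and counting the class by extensions -/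

/-- The permutation obtained from `π` by appending the value `v` on the right. -/
def append {n : ℕ} (π : Equiv.Perm (Fin n)) (v : Fin (n + 1)) : Equiv.Perm (Fin (n + 1)) :=
  (finSuccEquivLast.trans (Equiv.optionCongr π)).trans (finSuccEquiv' v).symm

section append

variable {n : ℕ} (π : Equiv.Perm (Fin n)) (v : Fin (n + 1)) (i j : Fin n) (g : ℕ)

theorem append_last : append π v (Fin.last n) = v := by
  simp [append]

theorem append_castSucc : append π v i.castSucc = v.succAbove (π i) := by
  simp [append]

theorem append_castSucc_lt_castSucc :
    append π v i.castSucc < append π v j.castSucc ↔ π i < π j := by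
  rw [append_castSucc, append_castSucc, Fin.succAbove_lt_succAbove_iff]

theorem val_append_castSucc :
    (append π v i.castSucc : ℕ) = if (π i : ℕ) < v then (π i : ℕ) else π i + 1 := by
  rw [append_castSucc, Fin.succAbove]
  simp only [Fin.lt_def, Fin.val_castSucc]
  split_ifs <;> simp

theorem append_last_lt_castSucc :
    append π v (Fin.last n) < append π v i.castSucc ↔ (v : ℕ) ≤ π i := by
  rw [Fin.lt_def, append_last, val_append_castSucc]
  split_ifs <;> omega

theorem append_castSucc_lt_last :
    append π v i.castSucc < append π v (Fin.last n) ↔ (π i : ℕ) < v := by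
  rw [Fin.lt_def, append_last, val_append_castSucc]
  split_ifs <;> omega

theorem val_append_castSucc_lt :
    (append π v i.castSucc : ℕ) < g ↔ (π i : ℕ) < oldGap v g := by
  rw [val_append_castSucc, oldGap]
  split_ifs <;> omega

theorem le_val_append_castSucc :
    g ≤ (append π v i.castSucc : ℕ) ↔ oldGap v g ≤ π i := by
  rw [← not_lt, val_append_castSucc_lt, not_lt]

end append

theorem append_injective (n : ℕ) :
    Function.Injective fun x : Equiv.Perm (Fin n) × Fin (n + 1) => append x.1 x.2 := by
  rintro ⟨π, v⟩ ⟨ρ, w⟩ h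
  simp only at h
  obtain rfl : v = w := by rw [← append_last π v, h, append_last]
  refine Prod.ext (Equiv.ext fun i => ?_) rfl
  have := append_castSucc π v i
  rw [h, append_castSucc] at this
  exact (Fin.succAbove_right_injective this).symm

theorem append_bijective (n : ℕ) :
    Function.Bijective fun x : Equiv.Perm (Fin n) × Fin (n + 1) => append x.1 x.2 := by
  rw [Fintype.bijective_iff_injective_and_card]
  refine ⟨append_injective n, ?_⟩
  simp [Fintype.card_perm, Nat.factorial_succ, mul_comm]

theorem Contains.append {k n : ℕ} {σ : Equiv.Perm (Fin k)} {π : Equiv.Perm (Fin n)}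
    (h : Contains σ π) (v : Fin (n + 1)) : Contains σ (append π v) := by
  obtain ⟨f, hf⟩ := h
  exact ⟨f.trans Fin.castSuccOrderEmb, fun i j => by
    simpa [append_castSucc_lt_castSucc] using hf i j⟩

section descendants

open Classical in
/-- The number of permutations in `Av B` that are obtained from `π` by appending `k` values, staying
in `Av B` throughout. -/
noncomputable def cntExt (B : Set (Σ k : ℕ, Equiv.Perm (Fin k))) :
    ℕ → (n : ℕ) → Equiv.Perm (Fin n) → ℕ
  | 0, _, _ => 1
  | k + 1, n, π => ∑ v : Fin (n + 1), if append π v ∈ Av B (n + 1)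
      then cntExt B k (n + 1) (append π v) else 0

open Classical in
-- The class is closed under deleting the last entry, so each member of length `n + k` is reached
-- from exactly one prefix, without leaving the class.
theorem sum_cntExt (B : Set (Σ k : ℕ, Equiv.Perm (Fin k))) (k n : ℕ) :
    (∑ π : Equiv.Perm (Fin n), if π ∈ Av B n then cntExt B k n π else 0) =
      (Av B (n + k)).ncard := by
  induction k generalizing n with
  | zero =>
    simp only [cntExt, Finset.sum_boole, Nat.cast_id]
    rw [← Set.ncard_coe_finset]
    simp
  | succ k ih =>
    rw [show n + (k + 1) = n + 1 + k by omega, ← ih,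
      ← (append_bijective n).sum_comp, Fintype.sum_prod_type]
    refine Finset.sum_congr rfl fun π _ => ?_
    split_ifs with h
    · rfl
    · refine (Finset.sum_eq_zero fun v _ => if_neg fun hv => h fun β hβ hc => ?_).symm
      exact hv β hβ (hc.append v)

theorem card_Av_eq_cntExt (B : Set (Σ k : ℕ, Equiv.Perm (Fin k))) (h0 : 1 ∈ Av B 0) (k : ℕ) :
    (Av B k).ncard = cntExt B k 0 1 := by
  have := sum_cntExt B k 0
  rw [zero_add] at this
  rw [← this, Fintype.sum_unique, Subsingleton.elim default (1 : Equiv.Perm (Fin 0)), if_pos h0]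

end descendants

/-! ### The patterns 2143 and 4321 and the state of a permutation -/

theorem contains_perm2143_iff {n : ℕ} (π : Equiv.Perm (Fin n)) :
    Contains perm2143 π ↔ ∃ i j k l, i < j ∧ j < k ∧ k < l ∧ π j < π i ∧ π i < π l ∧ π l < π k := by
  constructor
  · rintro ⟨f, hf⟩
    refine ⟨f 0, f 1, f 2, f 3, f.strictMono (by decide), f.strictMono (by decide),
      f.strictMono (by decide), (hf 1 0).2 (by decide), (hf 0 3).2 (by decide),
      (hf 3 2).2 (by decide)⟩
  · rintro ⟨i, j, k, l, hij, hjk, hkl, h1, h2, h3⟩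
    refine ⟨OrderEmbedding.ofStrictMono ![i, j, k, l] ?_, ?_⟩
    · rw [Fin.strictMono_iff_lt_succ]
      simp [Fin.forall_fin_succ, *]
    · simp only [Fin.forall_fin_succ, OrderEmbedding.coe_ofStrictMono, perm2143]
      simp
      omega

theorem contains_perm4321_iff {n : ℕ} (π : Equiv.Perm (Fin n)) :
    Contains perm4321 π ↔ ∃ i j k l, i < j ∧ j < k ∧ k < l ∧ π j < π i ∧ π k < π j ∧ π l < π k := by
  constructor
  · rintro ⟨f, hf⟩
    refine ⟨f 0, f 1, f 2, f 3, f.strictMono (by decide), f.strictMono (by decide),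
      f.strictMono (by decide), (hf 1 0).2 (by decide), (hf 2 1).2 (by decide),
      (hf 3 2).2 (by decide)⟩
  · rintro ⟨i, j, k, l, hij, hjk, hkl, h1, h2, h3⟩
    refine ⟨OrderEmbedding.ofStrictMono ![i, j, k, l] ?_, ?_⟩
    · rw [Fin.strictMono_iff_lt_succ]
      simp [Fin.forall_fin_succ, *]
    · simp only [Fin.forall_fin_succ, OrderEmbedding.coe_ofStrictMono, perm4321]
      simp
      omega

section existsLt

variable {n : ℕ}

theorem exists_lt_castSucc {P : Fin (n + 1) → Fin (n + 1) → Prop} :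
    (∃ i j, i < j ∧ P i j) ↔ (∃ i : Fin n, P i.castSucc (Fin.last n)) ∨
      ∃ i j : Fin n, i < j ∧ P i.castSucc j.castSucc := by
  simp [Fin.exists_iff_castSucc, Fin.castSucc_lt_last, (Fin.le_last _).not_gt, exists_or]

theorem exists_lt_lt_castSucc {P : Fin (n + 1) → Fin (n + 1) → Fin (n + 1) → Prop} :
    (∃ i j k, i < j ∧ j < k ∧ P i j k) ↔
      (∃ i j : Fin n, i < j ∧ P i.castSucc j.castSucc (Fin.last n)) ∨
      ∃ i j k : Fin n, i < j ∧ j < k ∧ P i.castSucc j.castSucc k.castSucc := by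
  simp [Fin.exists_iff_castSucc, Fin.castSucc_lt_last, (Fin.le_last _).not_gt, and_or_left,
    exists_or]

theorem exists_lt_lt_lt_castSucc
    {P : Fin (n + 1) → Fin (n + 1) → Fin (n + 1) → Fin (n + 1) → Prop} :
    (∃ i j k l, i < j ∧ j < k ∧ k < l ∧ P i j k l) ↔
      (∃ i j k : Fin n, i < j ∧ j < k ∧ P i.castSucc j.castSucc k.castSucc (Fin.last n)) ∨
      ∃ i j k l : Fin n, i < j ∧ j < k ∧ k < l ∧
        P i.castSucc j.castSucc k.castSucc l.castSucc := by
  simp [Fin.exists_iff_castSucc, Fin.castSucc_lt_last, (Fin.le_last _).not_gt, and_or_left,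
    exists_or]

end existsLt

/-- The least inversion top of `π` is `m` (or `m = n` if there is no inversion), its greatest
inversion bottom is `D - 1` (or `D = 0`), and appending a value to `π` creates no `2143` and no
`4321` precisely when the value lies in `S`. -/
structure HasState {n : ℕ} (π : Equiv.Perm (Fin n)) (m D : ℕ) (S : Finset ℕ) : Prop where
  top_le : m ≤ n
  bot_le : D ≤ n
  top_lt : ∀ g ≤ n, m < g ↔ ∃ i j, i < j ∧ π j < π i ∧ (π i : ℕ) < g
  lt_bot : ∀ g ≤ n, g < D ↔ ∃ i j, i < j ∧ π j < π i ∧ g ≤ (π j : ℕ)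
  mem : ∀ g, g ∈ S ↔ g ≤ n ∧
    (¬ ∃ i j k, i < j ∧ j < k ∧ π j < π i ∧ π k < π j ∧ g ≤ (π k : ℕ)) ∧
    ¬ ∃ i j k, i < j ∧ j < k ∧ π j < π i ∧ (π i : ℕ) < g ∧ g ≤ (π k : ℕ)

theorem hasState_zero (π : Equiv.Perm (Fin 0)) : HasState π 0 0 (Finset.range 1) where
  top_le := le_rfl
  bot_le := le_rfl
  top_lt := by simp
  lt_bot := by simp
  mem := by simp

/-- New inversions have bottom `v`, and their tops are the old values `≥ v`. A new 321 ends in `v`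
and exists iff `v < D`. For `g ≤ v`, a new obstruction of type 213 ends in `v` and exists iff some
inversion top is below `g`, that is, `m < g`. -/
theorem HasState.append {n m D : ℕ} {S : Finset ℕ} {π : Equiv.Perm (Fin n)} (h : HasState π m D S)
    (v : Fin (n + 1)) :
    HasState (append π v) (nextTop m v) (nextBot n D v) (nextSites n m D v S) := by
  have hv : (v : ℕ) ≤ n := Nat.lt_succ_iff.1 v.2
  have hm := h.top_le
  have hD := h.bot_le
  have hgap : ∀ g ≤ n + 1, oldGap v g ≤ n := fun g hg => by
    rw [oldGap]; split_ifs <;> omega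
  -- Every value below `n` is attained, so `v` itself is a witness when `v < g`.
  have hex : ∀ g ≤ n, (∃ i, (v : ℕ) ≤ π i ∧ (π i : ℕ) < g) ↔ (v : ℕ) < g := fun g hg =>
    ⟨fun ⟨i, h1, h2⟩ => by omega, fun h1 => ⟨π.symm ⟨v, by omega⟩, by simpa using h1⟩⟩
  refine ⟨?_, ?_, fun g hg => ?_, fun g hg => ?_, fun g => ?_⟩
  · rw [nextTop]; split_ifs <;> omega
  · rw [nextBot]; split_ifs <;> omega
  · have h1 := h.top_lt _ (hgap g hg)
    have h2 := hex _ (hgap g hg)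
    simp only [exists_lt_castSucc, append_castSucc_lt_castSucc, append_last_lt_castSucc,
      val_append_castSucc_lt]
    rw [← h1, h2, nextTop, oldGap]
    split_ifs <;> omega
  · have h1 := h.lt_bot _ (hgap g hg)
    have h2 := hex n le_rfl
    simp only [Fin.is_lt, and_true] at h2
    simp only [exists_lt_castSucc, append_castSucc_lt_castSucc, append_last_lt_castSucc,
      le_val_append_castSucc]
    rw [← h1, append_last, exists_and_right, h2, nextBot, oldGap]
    split_ifs <;> omega
  · have h1 := h.lt_bot v hv
    rw [nextSites, Finset.mem_filter, Finset.mem_range, h.mem]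
    simp only [exists_lt_lt_castSucc, append_castSucc_lt_castSucc, append_last_lt_castSucc,
      le_val_append_castSucc, val_append_castSucc_lt]
    simp only [append_last]
    by_cases hg : g ≤ n + 1
    · have hbot : (∃ i j, i < j ∧ π j < π i ∧ (v : ℕ) ≤ π j ∧ g ≤ v) ↔ (v : ℕ) < D ∧ g ≤ v := by
        rw [h1]
        simp only [← and_assoc, exists_and_right]
      have htop : (∃ i j, i < j ∧ π j < π i ∧ (π i : ℕ) < oldGap v g ∧ g ≤ v) ↔
          m < oldGap v g ∧ g ≤ v := by
        rw [h.top_lt _ (hgap g hg)]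
        simp only [← and_assoc, exists_and_right]
      rw [hbot, htop]
      have hlt : g < n + 2 := by omega
      simp only [hg, hlt, hgap g hg, true_and, not_or]
      by_cases hgv : g ≤ v
      · rw [show oldGap v g = g from if_pos hgv]
        simp only [hgv, and_true, not_lt.2 hgv, imp_false]
        tauto
      · simp only [hgv, and_false, not_false_eq_true, true_and, not_le.1 hgv, implies_true,
          and_true]
    · have hlt : ¬ g < n + 2 := by omega
      simp only [hg, hlt, false_and]

theorem HasState.append_mem_iff {n m D : ℕ} {S : Finset ℕ} {π : Equiv.Perm (Fin n)}
    (h : HasState π m D S) (hπ : π ∈ Av {⟨4, perm2143⟩, ⟨4, perm4321⟩} n) (v : Fin (n + 1)) :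
    PatternClass.append π v ∈ Av {⟨4, perm2143⟩, ⟨4, perm4321⟩} (n + 1) ↔ (v : ℕ) ∈ S := by
  have hv : (v : ℕ) ≤ n := Nat.lt_succ_iff.1 v.2
  simp only [Av, Set.mem_insert_iff, Set.mem_singleton_iff, forall_eq_or_imp, forall_eq,
    Set.mem_ofPred_eq, contains_perm2143_iff, contains_perm4321_iff] at hπ ⊢
  simp only [exists_lt_lt_lt_castSucc, append_castSucc_lt_castSucc, append_last_lt_castSucc,
    append_castSucc_lt_last, hπ.1, hπ.2, or_false, h.mem, hv, true_and]
  exact and_comm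

theorem HasState.cntExt_eq (k : ℕ) {n m D : ℕ} {S : Finset ℕ} {π : Equiv.Perm (Fin n)}
    (h : HasState π m D S) (hπ : π ∈ Av {⟨4, perm2143⟩, ⟨4, perm4321⟩} n) :
    cntExt {⟨4, perm2143⟩, ⟨4, perm4321⟩} k n π = cntState k n m D S := by
  induction k generalizing n m D S with
  | zero => rfl
  | succ k ih =>
    have hS : S = {g ∈ Finset.range (n + 1) | g ∈ S} := by
      ext g
      rw [Finset.mem_filter, Finset.mem_range, Nat.lt_succ_iff]
      exact ⟨fun hg => ⟨((h.mem g).1 hg).1, hg⟩, fun hg => hg.2⟩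
    have hsum : ∀ f : ℕ → ℕ, ∑ v ∈ S, f v = ∑ v : Fin (n + 1), if (v : ℕ) ∈ S then f v else 0 :=
      fun f => by
        rw [Fin.sum_univ_eq_sum_range fun g => if g ∈ S then f g else 0, ← Finset.sum_filter, ← hS]
    rw [cntExt, cntState, hsum]
    refine Finset.sum_congr rfl fun v _ => ?_
    by_cases hv : (v : ℕ) ∈ S
    · have hmem := (h.append_mem_iff hπ v).2 hv
      rw [if_pos hv, if_pos hmem, ih (h.append v) hmem]
    · rw [if_neg hv, if_neg fun hmem => hv ((h.append_mem_iff hπ v).1 hmem)]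

theorem card_Av_eq_cntIncr (k : ℕ) :
    (Av {⟨4, perm2143⟩, ⟨4, perm4321⟩} k).ncard = cntIncr k 0 := by
  have h0 : (1 : Equiv.Perm (Fin 0)) ∈ Av {⟨4, perm2143⟩, ⟨4, perm4321⟩} 0 := by
    rintro β hβ ⟨f, -⟩
    obtain rfl | rfl := hβ
    · exact (f 0).elim0
    · exact (f 0).elim0
  rw [card_Av_eq_cntExt _ h0, (hasState_zero 1).cntExt_eq k h0]
  exact cntState_incr k 0

theorem genFun_eq : genFun {⟨4, perm2143⟩, ⟨4, perm4321⟩} = serIncr 0 - 1 := by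
  ext n
  rw [genFun, serIncr, map_sub, coeff_mk, coeff_mk, card_Av_eq_cntIncr, coeff_one]
  split_ifs with hn
  · subst hn
    simp [cntIncr]
  · rw [sub_zero]

end PatternClass

/-- The generating function of `Av(2143, 4321)`. The power series that is inverted has constant
coefficient `1`, so `⁻¹` is its genuine inverse. -/
theorem mainTheorem2 :
    PatternClass.genFun {⟨4, PatternClass.perm2143⟩, ⟨4, PatternClass.perm4321⟩} =
      X * PatternClass.p *
        ((1 - 2 * X) ^ 4 * (1 - X) ^ 7 * (1 - 3 * X + X ^ 2) : ℚ⟦X⟧)⁻¹ := by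
  rw [PatternClass.genFun_eq, PatternClass.serIncr_zero_sub_one]
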